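/- Let $\nu$ be a reference measure on a measurable space $E$ (for example Lebesgue measure on $\mathbb{R}^d$), and let $\pi$ and $\pi^*$ be normalized probability densities with respect to $\nu$ such that the distribution $\pi(x)\,\nu(\mathrm{d}x)$ is absolutely continuous with respect to $\pi^*(x)\,\nu(\mathrm{d}x)$. Let $w=\pi/\pi^*$ be the importance ratio, and suppose that its essential supremum $w^*=\|w\|_\infty$ (with respect to the distribution with density $\pi^*$) is finite. Put $a=1-1/w^*$. Let $X_0,X_1,X_2,\dots$ be the independence Metropolis--Hastings chain with target $\pi$ and proposal $\pi^*$, started in equilibrium: $X_0\sim\pi$, and, given $X_0,\dots,X_t$ with $X_t=x$, a proposal $x'$ is drawn from $\pi^*$ and is accepted ($X_{t+1}=x'$) with probability $$\alpha(x,x')=\min\!\left(\frac{\pi(x')}{\pi(x)}\,\frac{\pi^*(x)}{\pi^*(x')},\,1\right)$$ (with $\alpha(x,x')=1$ where $\pi(x)\pi^*(x')=0$), and otherwise $X_{t+1}=x$. Then for every real-valued $g\in L^2(\pi)$ the integrated autocorrelation time $$\tau = 1+2\sum_{t=1}^\infty \rho_{gg}(t),\qquad \rho_{gg}(t)=\frac{\operatorname{Cov}(g(X_0),g(X_t))}{\operatorname{Var}(g(X_0))}$$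 (with $\rho_{gg}(t)=0$ if $g$ is $\pi$-almost everywhere constant) is well defined, i.e. the series converges absolutely, and $$\tau\le\frac{1+a}{1-a}.$$ -/

import Mathlib

open MeasureTheory ProbabilityTheory

namespace IndepMH

/-- `p` is a (normalized) probability density function with respect to the reference
measure `ν` (for instance Lebesgue measure on `ℝᵈ`). -/
structure IsProbDensity {E : Type*} [MeasurableSpace E] (ν : Measure E) (p : E → ℝ) : Prop where
  measurable : Measurable p
  nonneg : ∀ x, 0 ≤ p x
  integral_eq_one : ∫ x, p x ∂ν = 1

/-- The distribution `p(x) ν(dx)` with density `p`. -/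
noncomputable def law {E : Type*} [MeasurableSpace E] (ν : Measure E) (p : E → ℝ) : Measure E :=
  ν.withDensity (fun x => ENNReal.ofReal (p x))

/-- The importance ratio `w = p / q` of the target density `p` and the proposal density `q`. -/
noncomputable def ratio {E : Type*} (p q : E → ℝ) (x : E) : ℝ := p x / q x

/-- `‖w‖_∞`, the essential supremum (in `[0, ∞]`) of the importance ratio with respect to
the proposal distribution. -/
noncomputable def supRatio {E : Type*} [MeasurableSpace E] (ν : Measure E) (p q : E → ℝ) :
    ENNReal :=
  eLpNormEssSup (ratio p q) (law ν q)

/-- The Metropolis--Hastings ratio `h(x, y) = (p(y) / p(x)) (q(x) / q(y))`. -/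
noncomputable def mhRatio {E : Type*} (p q : E → ℝ) (x y : E) : ℝ :=
  p y / p x * (q x / q y)

/-- The acceptance probability `min (h(x, y), 1)`, with the usual convention that it is `1`
where `h(x, y)` is undefined, i.e. where `p(x) q(y) = 0`. -/
noncomputable def accept {E : Type*} (p q : E → ℝ) (x y : E) : ℝ :=
  open Classical in if p x * q y = 0 then 1 else min (mhRatio p q x y) 1

theorem IsProbDensity.isProbabilityMeasure_law {E : Type*} [MeasurableSpace E] {ν : Measure E}
    {p : E → ℝ} (hp : IsProbDensity ν p) : IsProbabilityMeasure (law ν p) := by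
  have hint : Integrable p ν := by
    by_contra h
    have h1 := hp.integral_eq_one
    rw [integral_undef h] at h1
    exact zero_ne_one h1
  refine ⟨?_⟩
  rw [law, withDensity_apply _ MeasurableSet.univ, Measure.restrict_univ,
    ← ofReal_integral_eq_lintegral_ofReal hint (Filter.Eventually.of_forall hp.nonneg),
    hp.integral_eq_one, ENNReal.ofReal_one]

theorem measurable_accept {E : Type*} [MeasurableSpace E] {p q : E → ℝ}
    (hp : Measurable p) (hq : Measurable q) :
    Measurable (fun z : E × E => accept p q z.1 z.2) := by
  classical
  unfold accept mhRatio
  refine Measurable.ite ?_ measurable_const ?_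
  · exact measurableSet_eq_fun (by fun_prop) measurable_const
  · fun_prop

/-- The transition kernel of the independence Metropolis--Hastings chain with target density
`p` and proposal density `q`: propose `y ∼ q`, move to `y` with probability `accept p q x y`,
otherwise stay at `x`. That is,
`P(x, A) = ∫_A accept(x, y) q(y) ν(dy) + (1 - ∫ accept(x, y) q(y) ν(dy)) δ_x(A)`. -/
noncomputable def mhKernel {E : Type*} [MeasurableSpace E] (ν : Measure E) {p q : E → ℝ}
    (hp : IsProbDensity ν p) (hq : IsProbDensity ν q) : Kernel E E where
  toFun x := (law ν q).withDensity (fun y => ENNReal.ofReal (accept p q x y)) +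
    (1 - ∫⁻ y, ENNReal.ofReal (accept p q x y) ∂(law ν q)) • Measure.dirac x
  measurable' := by
    have := hq.isProbabilityMeasure_law
    have hα := (measurable_accept hp.measurable hq.measurable).ennreal_ofReal
    refine Measure.measurable_of_measurable_coe _ fun s hs => ?_
    simp only [Measure.add_apply, Measure.smul_apply, smul_eq_mul, withDensity_apply _ hs]
    exact hα.lintegral_prod_right'.add
      ((measurable_const.sub hα.lintegral_prod_right').mul
        ((Measure.measurable_coe hs).comp Measure.measurable_dirac))

/-- Under `μ`, the process `X` is a time-homogeneous Markov chain with transition kernel `κ` and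
initial distribution `μ₀`: given the past `(X 0, …, X n)`, the conditional distribution of
`X (n + 1)` is `κ (X n)`. -/
structure IsMarkovChain {Ω E : Type*} [MeasurableSpace Ω] [MeasurableSpace E]
    (μ : Measure Ω) (X : ℕ → Ω → E) (κ : Kernel E E) (μ₀ : Measure E) : Prop where
  measurable : ∀ n, Measurable (X n)
  initial : μ.map (X 0) = μ₀
  transition : ∀ (n : ℕ) (A : Set (Fin (n + 1) → E)) (B : Set E),
    MeasurableSet A → MeasurableSet B →
      μ {ω | (fun i : Fin (n + 1) => X i ω) ∈ A ∧ X (n + 1) ω ∈ B} =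
        ∫⁻ ω in {ω | (fun i : Fin (n + 1) => X i ω) ∈ A}, κ (X n ω) B ∂μ

/-- The autocorrelation coefficient `ρ_gg(t) = Cov(g(X₀), g(X_t)) / Var(g(X₀))` at lag `t`, in
the statistic `g`, of a stationary chain `X`. -/
noncomputable def autocorr {Ω E : Type*} [MeasurableSpace Ω]
    (μ : Measure Ω) (X : ℕ → Ω → E) (g : E → ℝ) (t : ℕ) : ℝ :=
  covariance (fun ω => g (X 0 ω)) (fun ω => g (X t ω)) μ / variance (fun ω => g (X 0 ω)) μ

/-- The integrated autocorrelation time `τ = 1 + 2 ∑_{t ≥ 1} ρ_gg(t)`. -/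
noncomputable def iact {Ω E : Type*} [MeasurableSpace Ω]
    (μ : Measure Ω) (X : ℕ → Ω → E) (g : E → ℝ) : ℝ :=
  1 + 2 * ∑' t : ℕ, autocorr μ X g (t + 1)

end IndepMH

namespace IndepMH

/-! With `c = 1 / w*`, accepted proposals alone give the Doeblin minorization `c • π ≤ κ x` for
almost every `x` (`ae_smul_law_le_mhKernel`). Subtracting `c • π` from `κ x` does not change the
integral of a mean-zero function and leaves mass `1 - c = a`. So Cauchy–Schwarz, together with
invariance of `π`, makes the kernel contract mean-zero functions in `L²(π)` by the factor `a`
(`integral_sq_integral_kernel_le`). Iterating along the chain gives `|ρ(t)| ≤ a ^ t`, and the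
geometric series sums to `1 + 2a / (1 - a) = (1 + a) / (1 - a)`. Invariance comes from detailed
balance. -/

theorem sq_integral_mul_le {E : Type*} [MeasurableSpace E] {π : Measure E} {f h : E → ℝ}
    (hf : MemLp f 2 π) (hh : MemLp h 2 π) :
    (∫ x, h x * f x ∂π) ^ 2 ≤ (∫ x, h x ^ 2 ∂π) * ∫ x, f x ^ 2 ∂π := by
  have key : ∀ s : ℝ, 0 ≤ (∫ x, f x ^ 2 ∂π) * (s * s) + (2 * ∫ x, h x * f x ∂π) * s
      + ∫ x, h x ^ 2 ∂π := by
    intro s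
    have h1 : Integrable (fun x => s * s * f x ^ 2) π := hf.integrable_sq.const_mul _
    have h2 : Integrable (fun x => 2 * s * (h x * f x)) π :=
      (hh.integrable_mul hf).const_mul _
    have h3 : ∫ x, (s * f x + h x) ^ 2 ∂π
        = ∫ x, (s * s * f x ^ 2 + 2 * s * (h x * f x)) + h x ^ 2 ∂π := by
      congr 1 with x; ring
    rw [integral_add (by exact h1.add h2) hh.integrable_sq, integral_add h1 h2,
      integral_const_mul, integral_const_mul] at h3
    have h4 : 0 ≤ ∫ x, (s * f x + h x) ^ 2 ∂π := integral_nonneg fun x => sq_nonneg _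
    rw [h3] at h4
    linarith
  have := discrim_le_zero key
  rw [discrim] at this
  linarith

/-! ### L² contraction from a minorization condition -/

section Minorization

variable {E : Type*} [MeasurableSpace E] {π : Measure E} {κ : Kernel E E} {c : NNReal} {f : E → ℝ}

theorem ae_integrable_kernel (hinv : Kernel.Invariant κ π) (hf : Integrable f π) :
    ∀ᵐ x ∂π, Integrable f (κ x) := by
  rw [← hinv.def] at hf
  exact Measure.ae_integrable_of_integrable_comp hf

theorem integrable_comp_const (hinv : Kernel.Invariant κ π) (hf : Integrable f π) :
    Integrable f ((κ ∘ₖ Kernel.const Unit π) ()) := by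
  rwa [← Measure.comp_eq_comp_const_apply, hinv.def]

theorem integrable_integral_kernel (hinv : Kernel.Invariant κ π) (hf : Integrable f π) :
    Integrable (fun x => ∫ y, f y ∂κ x) π := by
  have := (integrable_comp_const hinv hf).integral_comp
  rwa [Kernel.const_apply] at this

theorem integral_integral_kernel (hinv : Kernel.Invariant κ π) (hf : Integrable f π) :
    ∫ x, ∫ y, f y ∂κ x ∂π = ∫ x, f x ∂π := by
  have := Kernel.integral_comp (integrable_comp_const hinv hf)
  rw [Kernel.const_apply, ← Measure.comp_eq_comp_const_apply, hinv.def] at this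
  exact this.symm

theorem measurable_integral_kernel (hf : Measurable f) : Measurable fun x => ∫ y, f y ∂κ x :=
  (hf.stronglyMeasurable.integral_kernel (κ := κ)).measurable

variable [IsProbabilityMeasure π] [IsMarkovKernel κ]

/-- Cauchy–Schwarz for `1` and `f` under the residual measure `κ x - c • π`, of mass `1 - c`. The
discriminant of the quadratic `s ↦ ∫ (s - f)²` against it avoids subtracting measures. -/
theorem sq_integral_kernel_le (hinv : Kernel.Invariant κ π) (hmin : ∀ᵐ x ∂π, c • π ≤ κ x)
    (hf : MemLp f 2 π) (hf0 : ∫ x, f x ∂π = 0) :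
    ∀ᵐ x ∂π, (∫ y, f y ∂κ x) ^ 2 ≤ (1 - c) * ((∫ y, f y ^ 2 ∂κ x) - c * ∫ y, f y ^ 2 ∂π) := by
  have hfi : Integrable f π := hf.integrable one_le_two
  filter_upwards [hmin, ae_integrable_kernel hinv hfi,
    ae_integrable_kernel hinv hf.integrable_sq] with x hx h1 h2
  have expand : ∀ (m : Measure E) [IsProbabilityMeasure m] (s : ℝ), Integrable f m →
      Integrable (fun y => f y ^ 2) m →
      Integrable (fun y => (s - f y) ^ 2) m ∧
      ∫ y, (s - f y) ^ 2 ∂m = s * s - 2 * s * (∫ y, f y ∂m) + ∫ y, f y ^ 2 ∂m := by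
    intro m _ s i1 i2
    have e : (fun y => (s - f y) ^ 2) = fun y => (s * s - 2 * s * f y) + f y ^ 2 := by
      ext y; ring
    have i3 : Integrable (fun y => s * s - 2 * s * f y) m :=
      (integrable_const _).sub (i1.const_mul _)
    rw [e]
    refine ⟨i3.add i2, ?_⟩
    rw [integral_add i3 i2, integral_sub (integrable_const _) (i1.const_mul _),
      integral_const_mul (2 * s)]
    simp
  have key : ∀ s : ℝ, 0 ≤ (1 - (c : ℝ)) * (s * s) + (-2 * ∫ y, f y ∂κ x) * s
      + ((∫ y, f y ^ 2 ∂κ x) - c * ∫ y, f y ^ 2 ∂π) := by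
    intro s
    obtain ⟨j1, e1⟩ := expand (κ x) s h1 h2
    obtain ⟨-, e2⟩ := expand π s hfi hf.integrable_sq
    have := integral_mono_measure hx (Filter.Eventually.of_forall fun y => sq_nonneg (s - f y)) j1
    rw [integral_smul_nnreal_measure, NNReal.smul_def, smul_eq_mul, e1, e2, hf0] at this
    linarith
  have := discrim_le_zero key
  rw [discrim] at this
  linarith

theorem memLp_integral_kernel (hinv : Kernel.Invariant κ π) (hmin : ∀ᵐ x ∂π, c • π ≤ κ x)
    (hm : Measurable f) (hf : MemLp f 2 π) (hf0 : ∫ x, f x ∂π = 0) :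
    MemLp (fun x => ∫ y, f y ∂κ x) 2 π := by
  rw [memLp_two_iff_integrable_sq (measurable_integral_kernel hm).aestronglyMeasurable]
  refine Integrable.mono'
    (((integrable_integral_kernel hinv hf.integrable_sq).sub
      (integrable_const (c * ∫ y, f y ^ 2 ∂π))).const_mul (1 - (c : ℝ)))
    ((measurable_integral_kernel hm).pow_const 2).aestronglyMeasurable ?_
  filter_upwards [sq_integral_kernel_le hinv hmin hf hf0] with x hx
  rw [Real.norm_of_nonneg (sq_nonneg _)]
  exact hx

/-- One factor `1 - c` is the residual mass; the other appears because, by invariance, averaging `∫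
f² dκ x - c ∫ f² dπ` over `π` gives `(1 - c) ∫ f² dπ`. -/
theorem integral_sq_integral_kernel_le (hinv : Kernel.Invariant κ π)
    (hmin : ∀ᵐ x ∂π, c • π ≤ κ x)
    (hm : Measurable f) (hf : MemLp f 2 π) (hf0 : ∫ x, f x ∂π = 0) :
    ∫ x, (∫ y, f y ∂κ x) ^ 2 ∂π ≤ (1 - c) ^ 2 * ∫ x, f x ^ 2 ∂π := by
  have hi := integrable_integral_kernel hinv hf.integrable_sq
  have := integral_mono_ae (memLp_integral_kernel hinv hmin hm hf hf0).integrable_sq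
    ((hi.sub (integrable_const (c * ∫ y, f y ^ 2 ∂π))).const_mul (1 - (c : ℝ)))
    (sq_integral_kernel_le hinv hmin hf hf0)
  refine this.trans_eq ?_
  simp only [Pi.sub_apply]
  rw [integral_const_mul, integral_sub hi (integrable_const _),
    integral_integral_kernel hinv hf.integrable_sq]
  simp
  ring

end Minorization

/-! ### Decay of correlations along the chain -/

namespace IsMarkovChain

variable {Ω E : Type*} [MeasurableSpace Ω] [MeasurableSpace E] {μ : Measure Ω}
  {X : ℕ → Ω → E} {κ : Kernel E E} {π : Measure E}

theorem map_eq (hX : IsMarkovChain μ X κ π) (hinv : Kernel.Invariant κ π) (n : ℕ) :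
    μ.map (X n) = π := by
  induction n with
  | zero => exact hX.initial
  | succ n ih =>
    ext B hB
    have h := hX.transition n Set.univ B MeasurableSet.univ hB
    simp only [Set.mem_univ, true_and, Set.ofPred_true, Measure.restrict_univ] at h
    rw [Measure.map_apply (hX.measurable _) hB]
    refine h.trans ?_
    conv_rhs => rw [← hinv.def, Measure.bind_apply hB κ.aemeasurable]
    rw [← ih, lintegral_map (κ.measurable_coe hB) (hX.measurable n)]

theorem memLp_comp (hX : IsMarkovChain μ X κ π) (hinv : Kernel.Invariant κ π) {f : E → ℝ}
    (hf : MemLp f 2 π) (n : ℕ) : MemLp (fun ω => f (X n ω)) 2 μ := by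
  rw [← hX.map_eq hinv n] at hf
  exact hf.comp_of_map (hX.measurable n).aemeasurable

theorem integral_comp_eq (hX : IsMarkovChain μ X κ π) (hinv : Kernel.Invariant κ π) {f : E → ℝ}
    (hf : Measurable f) (n : ℕ) : ∫ ω, f (X n ω) ∂μ = ∫ x, f x ∂π := by
  rw [← hX.map_eq hinv n, integral_map (hX.measurable n).aemeasurable hf.aestronglyMeasurable]

variable [IsProbabilityMeasure μ] [IsMarkovKernel κ]

/-- Recasts the Markov property on rectangles as an identity of measures, so that integrals over
past and next state can be computed by Fubini. -/
theorem map_path_prod (hX : IsMarkovChain μ X κ π) (n : ℕ) :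
    μ.map (fun ω => ((fun i : Fin (n + 1) => X i ω), X (n + 1) ω)) =
      (μ.map fun ω => (fun i : Fin (n + 1) => X i ω)) ⊗ₘ
        κ.comap (fun z : Fin (n + 1) → E => z (Fin.last n)) (measurable_pi_apply _) := by
  have hY : Measurable fun ω => (fun i : Fin (n + 1) => X i ω) :=
    measurable_pi_lambda _ fun i => hX.measurable i
  have hZ := hY.prodMk (hX.measurable (n + 1))
  have := Measure.isProbabilityMeasure_map (μ := μ) hZ.aemeasurable
  have := Measure.isProbabilityMeasure_map (μ := μ) hY.aemeasurable
  refine Measure.ext_prod fun {s t} hs ht => ?_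
  rw [Measure.map_apply hZ (hs.prod ht), Measure.compProd_apply_prod hs ht,
    setLIntegral_map hs (Kernel.measurable_coe _ ht) hY]
  simpa using! hX.transition n s t hs ht

theorem integral_mul_succ (hX : IsMarkovChain μ X κ π) (hinv : Kernel.Invariant κ π)
    {h f : E → ℝ} (hhm : Measurable h) (hfm : Measurable f)
    (hh : MemLp h 2 π) (hf : MemLp f 2 π) (n : ℕ) :
    ∫ ω, h (X 0 ω) * f (X (n + 1) ω) ∂μ = ∫ ω, h (X 0 ω) * ∫ y, f y ∂κ (X n ω) ∂μ := by
  have hY : Measurable fun ω => (fun i : Fin (n + 1) => X i ω) :=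
    measurable_pi_lambda _ fun i => hX.measurable i
  have hZ := hY.prodMk (hX.measurable (n + 1))
  have := Measure.isProbabilityMeasure_map (μ := μ) hY.aemeasurable
  have hF : Measurable fun z : (Fin (n + 1) → E) × E => h (z.1 0) * f z.2 := by fun_prop
  have hint : Integrable (fun z : (Fin (n + 1) → E) × E => h (z.1 0) * f z.2)
      (μ.map fun ω => ((fun i : Fin (n + 1) => X i ω), X (n + 1) ω)) := by
    rw [integrable_map_measure hF.aestronglyMeasurable hZ.aemeasurable]
    exact (hX.memLp_comp hinv hh 0).integrable_mul (hX.memLp_comp hinv hf (n + 1))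
  have e1 := integral_map (μ := μ) hZ.aemeasurable hF.aestronglyMeasurable
  simp only [Fin.val_zero] at e1
  rw [← e1]
  rw [hX.map_path_prod n] at hint ⊢
  rw [Measure.integral_compProd hint]
  simp only [integral_const_mul, Kernel.comap_apply]
  have hG : Measurable fun z : Fin (n + 1) → E => h (z 0) * ∫ y, f y ∂κ (z (Fin.last n)) :=
    (hhm.comp (measurable_pi_apply _)).mul
      ((measurable_integral_kernel hfm).comp (measurable_pi_apply _))
  rw [integral_map hY.aemeasurable hG.aestronglyMeasurable]
  simp

/-- Conditioning on the past trades the last step for one application of the kernel to `f`, which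
stays centred and costs `(1 - c)²`. Hence the induction fixes `h` and varies `f`. -/
theorem sq_integral_mul_le (hX : IsMarkovChain μ X κ π) [IsProbabilityMeasure π]
    (hinv : Kernel.Invariant κ π)
    {c : NNReal} (hmin : ∀ᵐ x ∂π, c • π ≤ κ x) {h f : E → ℝ} (hhm : Measurable h)
    (hfm : Measurable f) (hh : MemLp h 2 π) (hf : MemLp f 2 π) (hf0 : ∫ x, f x ∂π = 0) (n : ℕ) :
    (∫ ω, h (X 0 ω) * f (X n ω) ∂μ) ^ 2 ≤
      ((1 - c : ℝ) ^ n) ^ 2 * ((∫ x, h x ^ 2 ∂π) * ∫ x, f x ^ 2 ∂π) := by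
  induction n generalizing f with
  | zero =>
    rw [hX.integral_comp_eq hinv (f := fun x => h x * f x) (hhm.mul hfm) 0]
    simpa using IndepMH.sq_integral_mul_le hf hh
  | succ n ih =>
    rw [hX.integral_mul_succ hinv hhm hfm hh hf]
    refine (ih (measurable_integral_kernel hfm) (memLp_integral_kernel hinv hmin hfm hf hf0)
      ((integral_integral_kernel hinv (hf.integrable one_le_two)).trans hf0)).trans ?_
    have h0 : 0 ≤ ∫ x, h x ^ 2 ∂π := integral_nonneg fun x => sq_nonneg _
    calc _ ≤ ((1 - c : ℝ) ^ n) ^ 2 * ((∫ x, h x ^ 2 ∂π) * ((1 - c) ^ 2 * ∫ x, f x ^ 2 ∂π)) := by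
          gcongr
          exact integral_sq_integral_kernel_le hinv hmin hfm hf hf0
      _ = _ := by ring

theorem abs_autocorr_le (hX : IsMarkovChain μ X κ π) [IsProbabilityMeasure π]
    (hinv : Kernel.Invariant κ π) {c : NNReal} (hc : c ≤ 1) (hmin : ∀ᵐ x ∂π, c • π ≤ κ x)
    {g : E → ℝ} (hg : MemLp g 2 π) (n : ℕ) : |autocorr μ X g n| ≤ (1 - c : ℝ) ^ n := by
  have hc' : (0 : ℝ) ≤ 1 - c := sub_nonneg.2 (by exact_mod_cast hc)
  -- `g` is only a.e. measurable; each `X t` has law `π`, so a measurable version can replace it at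
  -- every time.
  obtain ⟨g', hg'm, hgg'⟩ := hg.aestronglyMeasurable.aemeasurable
  have hg' : MemLp g' 2 π := (memLp_congr_ae hgg').1 hg
  have hae : ∀ t, (fun ω => g (X t ω)) =ᵐ[μ] fun ω => g' (X t ω) := fun t => by
    rw [← hX.map_eq hinv t] at hgg'
    exact ae_of_ae_map (hX.measurable t).aemeasurable hgg'
  set m := ∫ x, g' x ∂π with hm
  set f : E → ℝ := fun x => g' x - m with hfdef
  have hfm : Measurable f := hg'm.sub_const m
  have hf : MemLp f 2 π := hg'.sub (memLp_const m)
  have hf0 : ∫ x, f x ∂π = 0 := by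
    rw [hfdef, integral_sub (hg'.integrable one_le_two) (integrable_const _)]
    simp [hm]
  have hmean : ∀ t, ∫ ω, g (X t ω) ∂μ = m := fun t => by
    rw [integral_congr_ae (hae t), hX.integral_comp_eq hinv hg'm]
  have hcov : ∀ t, covariance (fun ω => g (X 0 ω)) (fun ω => g (X t ω)) μ
      = ∫ ω, f (X 0 ω) * f (X t ω) ∂μ := fun t => by
    rw [covariance]
    refine integral_congr_ae ?_
    filter_upwards [hae 0, hae t] with ω h0 ht
    simp only [hmean, h0, ht, hfdef]
  have hvar : variance (fun ω => g (X 0 ω)) μ = ∫ x, f x ^ 2 ∂π := by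
    rw [← covariance_self, hcov 0, ← hX.integral_comp_eq hinv (hfm.pow_const 2) 0]
    · simp only [pow_two]
    · exact (hg'm.comp (hX.measurable 0)).aemeasurable.congr (hae 0).symm
  have hV : 0 ≤ ∫ x, f x ^ 2 ∂π := integral_nonneg fun x => sq_nonneg _
  have hbound : |∫ ω, f (X 0 ω) * f (X n ω) ∂μ| ≤ (1 - c : ℝ) ^ n * ∫ x, f x ^ 2 ∂π := by
    refine abs_le_of_sq_le_sq ?_ (by positivity)
    refine (hX.sq_integral_mul_le hinv hmin hfm hfm hf hf hf0 n).trans_eq ?_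
    ring
  rw [autocorr, hcov, hvar, abs_div, abs_of_nonneg hV]
  -- If the variance vanishes, the quotient is `0` and the bound still holds.
  exact div_le_of_le_mul₀ hV (by positivity) hbound

theorem summable_autocorr_and_iact_le (hX : IsMarkovChain μ X κ π) [IsProbabilityMeasure π]
    (hinv : Kernel.Invariant κ π) {c : NNReal} (hc0 : 0 < c) (hc : c ≤ 1)
    (hmin : ∀ᵐ x ∂π, c • π ≤ κ x) {g : E → ℝ} (hg : MemLp g 2 π) :
    Summable (fun t : ℕ => autocorr μ X g (t + 1)) ∧
      iact μ X g ≤ (1 + (1 - c)) / (1 - (1 - c)) := by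
  have hc' : (0 : ℝ) ≤ 1 - c := sub_nonneg.2 (by exact_mod_cast hc)
  have hc0' : (0 : ℝ) < c := hc0
  have hle := fun t => hX.abs_autocorr_le hinv hc hmin hg (t + 1)
  have hgeo : HasSum (fun t : ℕ => (1 - c : ℝ) ^ (t + 1)) ((1 - (1 - c) : ℝ)⁻¹ * (1 - c)) := by
    simpa only [pow_succ] using
      (hasSum_geometric_of_lt_one hc' (by linarith)).mul_right (1 - c : ℝ)
  have hs : Summable (fun t : ℕ => autocorr μ X g (t + 1)) :=
    Summable.of_norm_bounded hgeo.summable hle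
  refine ⟨hs, ?_⟩
  have := hs.tsum_le_tsum (fun t => (le_abs_self _).trans (hle t)) hgeo.summable
  rw [hgeo.tsum_eq] at this
  rw [iact]
  calc _ ≤ 1 + 2 * ((1 - (1 - (c : ℝ)))⁻¹ * (1 - c)) := by linarith
    _ = _ := by
      rw [sub_sub_cancel]
      field_simp
      ring

end IsMarkovChain

/-! ### Detailed balance and minorization for the sampler -/

theorem accept_le_one {E : Type*} {p q : E → ℝ} (x y : E) : accept p q x y ≤ 1 := by
  unfold accept
  split_ifs
  · exact le_rfl
  · exact min_le_right _ _

section MetropolisHastings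

variable {E : Type*} [MeasurableSpace E] {ν : Measure E} {p q : E → ℝ}

theorem measurable_ratio (hp : IsProbDensity ν p) (hq : IsProbDensity ν q) :
    Measurable (ratio p q) :=
  hp.measurable.div hq.measurable

theorem ratio_nonneg (hp : IsProbDensity ν p) (hq : IsProbDensity ν q) (x : E) :
    0 ≤ ratio p q x :=
  div_nonneg (hp.nonneg x) (hq.nonneg x)

/-- Detailed balance for accepted moves: the right side is symmetric in `x` and `y`. -/
theorem ratio_mul_accept (hp : IsProbDensity ν p) (hq : IsProbDensity ν q) {x y : E}
    (hx : 0 < q x) (hy : 0 < q y) :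
    ratio p q x * accept p q x y = min (ratio p q x) (ratio p q y) := by
  rcases (hp.nonneg x).eq_or_lt with h | h
  · simp [ratio, ← h, div_nonneg (hp.nonneg y) hy.le]
  · have h' : 0 ≤ p x / q x := div_nonneg h.le hx.le
    rw [accept, if_neg (mul_pos h hy).ne', mul_min_of_nonneg _ _ (ratio_nonneg hp hq x), mul_one,
      min_comm, mhRatio]
    congr 1
    simp only [ratio]
    field_simp

/-- Where `p x > 0`, acceptance is `min (w y / w x) 1`, and both entries are at least `w y / M`. -/
theorem ratio_le_mul_accept (hp : IsProbDensity ν p) (hq : IsProbDensity ν q) {x y : E} {M : ℝ}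
    (hx : 0 < q x) (hy : 0 < q y) (hxM : ratio p q x ≤ M) (hyM : ratio p q y ≤ M) :
    ratio p q y ≤ M * accept p q x y := by
  have hM : 0 ≤ M := (ratio_nonneg hp hq x).trans hxM
  rcases (hp.nonneg x).eq_or_lt with h | h
  · simpa [accept, ← h] using hyM
  · rw [accept, if_neg (mul_pos h hy).ne', mul_min_of_nonneg _ _ hM, mul_one]
    refine le_min ?_ hyM
    have e : mhRatio p q x y = ratio p q y / ratio p q x := by
      simp only [mhRatio, ratio]
      field_simp
    have hr : 0 < ratio p q x := div_pos h hx
    rw [e, mul_div_assoc', le_div_iff₀ hr, mul_comm M]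
    exact mul_le_mul_of_nonneg_left hxM (ratio_nonneg hp hq y)

theorem ae_law_pos (hq : IsProbDensity ν q) : ∀ᵐ x ∂law ν q, 0 < q x := by
  rw [law, ae_withDensity_iff hq.measurable.ennreal_ofReal]
  exact Filter.Eventually.of_forall fun x hx => by simpa using hx

theorem law_eq_withDensity_ratio (hp : IsProbDensity ν p) (hq : IsProbDensity ν q)
    (hac : law ν p ≪ law ν q) :
    law ν p = (law ν q).withDensity fun x => ENNReal.ofReal (ratio p q x) := by
  -- Absolute continuity rules out target mass where `q = 0`, the only place where `q * (p / q) = p`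
  -- could fail.
  have h1 : ∀ᵐ x ∂ν, ENNReal.ofReal (p x) ≠ 0 → 0 < q x := by
    rw [← ae_withDensity_iff hp.measurable.ennreal_ofReal]
    exact hac (ae_law_pos hq)
  rw [law, law, ← withDensity_mul _ hq.measurable.ennreal_ofReal
    (measurable_ratio hp hq).ennreal_ofReal]
  refine withDensity_congr_ae ?_
  filter_upwards [h1] with x hx
  rw [Pi.mul_apply, ← ENNReal.ofReal_mul (hq.nonneg x), ratio]
  by_cases h : ENNReal.ofReal (p x) = 0
  · have : p x = 0 := le_antisymm (by simpa using h) (hp.nonneg x)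
    simp [this]
  · rw [mul_div_cancel₀ _ (hx h).ne']

theorem mhKernel_apply (hp : IsProbDensity ν p) (hq : IsProbDensity ν q) (x : E) :
    mhKernel ν hp hq x = (law ν q).withDensity (fun y => ENNReal.ofReal (accept p q x y)) +
      (1 - ∫⁻ y, ENNReal.ofReal (accept p q x y) ∂(law ν q)) • Measure.dirac x :=
  rfl

theorem mhKernel_apply_apply (hp : IsProbDensity ν p) (hq : IsProbDensity ν q) (x : E)
    {B : Set E} (hB : MeasurableSet B) :
    mhKernel ν hp hq x B = ∫⁻ y in B, ENNReal.ofReal (accept p q x y) ∂(law ν q) +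
      B.indicator (fun x => 1 - ∫⁻ y, ENNReal.ofReal (accept p q x y) ∂(law ν q)) x := by
  rw [mhKernel_apply, Measure.add_apply, Measure.smul_apply, withDensity_apply _ hB,
    Measure.dirac_apply' _ hB]
  by_cases h : x ∈ B <;> simp [h]

theorem isMarkovKernel_mhKernel (hp : IsProbDensity ν p) (hq : IsProbDensity ν q) :
    IsMarkovKernel (mhKernel ν hp hq) := by
  have := hq.isProbabilityMeasure_law
  refine ⟨fun x => ⟨?_⟩⟩
  rw [mhKernel_apply_apply hp hq x MeasurableSet.univ, Measure.restrict_univ, Set.indicator_univ]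
  refine add_tsub_cancel_of_le ?_
  calc ∫⁻ y, ENNReal.ofReal (accept p q x y) ∂(law ν q) ≤ ∫⁻ _, 1 ∂(law ν q) :=
        lintegral_mono fun y => ENNReal.ofReal_le_one.2 (accept_le_one x y)
    _ = 1 := by simp

theorem isReversible_mhKernel (hp : IsProbDensity ν p) (hq : IsProbDensity ν q)
    (hac : law ν p ≪ law ν q) : (mhKernel ν hp hq).IsReversible (law ν p) := by
  have := hq.isProbabilityMeasure_law
  have hα := (measurable_accept hp.measurable hq.measurable).ennreal_ofReal
  have hw := measurable_ratio hp hq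
  set r : E → ENNReal := fun x => 1 - ∫⁻ y, ENNReal.ofReal (accept p q x y) ∂(law ν q) with hr
  -- The flow from `A` to `B` splits into accepted moves, with the symmetric density `min (w x) (w
  -- y)`, and rejections, which live on `B ∩ A`.
  have flow : ∀ {A B : Set E}, MeasurableSet A → MeasurableSet B →
      ∫⁻ x in A, mhKernel ν hp hq x B ∂(law ν p) =
        (∫⁻ x in A, ∫⁻ y in B, ENNReal.ofReal (min (ratio p q x) (ratio p q y)) ∂(law ν q)
          ∂(law ν q)) + ∫⁻ x in B ∩ A, ENNReal.ofReal (ratio p q x) * r x ∂(law ν q) := by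
    intro A B hA hB
    rw [law_eq_withDensity_ratio hp hq hac,
      setLIntegral_withDensity_eq_setLIntegral_mul _ hw.ennreal_ofReal
        ((mhKernel ν hp hq).measurable_coe hB) hA, ← setLIntegral_indicator hB,
      ← lintegral_add_left]
    · refine lintegral_congr_ae (ae_restrict_of_ae ?_)
      filter_upwards [ae_law_pos hq] with x hx
      rw [Pi.mul_apply, mhKernel_apply_apply hp hq x hB, mul_add]
      congr 1
      · have hαx : Measurable fun y => ENNReal.ofReal (accept p q x y) :=
          hα.comp measurable_prodMk_left
        rw [← lintegral_const_mul _ hαx]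
        refine lintegral_congr_ae (ae_restrict_of_ae ?_)
        filter_upwards [ae_law_pos hq] with y hy
        rw [← ratio_mul_accept hp hq hx hy, ENNReal.ofReal_mul (ratio_nonneg hp hq x)]
      · by_cases h : x ∈ B <;> simp [h, hr]
    · exact Measurable.lintegral_prod_right'
        (f := fun z : E × E => ENNReal.ofReal (min (ratio p q z.1) (ratio p q z.2)))
        ((hw.comp measurable_fst).min (hw.comp measurable_snd)).ennreal_ofReal
  intro A B hA hB
  rw [flow hA hB, flow hB hA, Set.inter_comm A B, lintegral_lintegral_swap]
  · simp only [min_comm]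
  · exact ((hw.comp measurable_fst).min (hw.comp measurable_snd)).ennreal_ofReal.aemeasurable

theorem ae_ratio_le (hp : IsProbDensity ν p) (hq : IsProbDensity ν q)
    (hw : supRatio ν p q < ⊤) : ∀ᵐ x ∂law ν q, ratio p q x ≤ (supRatio ν p q).toReal := by
  filter_upwards [ae_le_eLpNormEssSup (f := ratio p q) (μ := law ν q)] with x hx
  rw [← ENNReal.ofReal_le_iff_le_toReal hw.ne]
  rwa [← ofReal_norm, Real.norm_of_nonneg (ratio_nonneg hp hq x)] at hx

/-- The mean of `w` under the proposal is `1`. This ensures `0 < 1 / w* ≤ 1` once `w*` is finite. -/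
theorem one_le_supRatio (hp : IsProbDensity ν p) (hq : IsProbDensity ν q)
    (hac : law ν p ≪ law ν q) : 1 ≤ supRatio ν p q := by
  have := hp.isProbabilityMeasure_law
  have := hq.isProbabilityMeasure_law
  calc 1 = law ν p Set.univ := measure_univ.symm
    _ = ∫⁻ x, ENNReal.ofReal (ratio p q x) ∂law ν q := by
      rw [law_eq_withDensity_ratio hp hq hac, withDensity_apply _ MeasurableSet.univ,
        Measure.restrict_univ]
    _ ≤ ∫⁻ _, supRatio ν p q ∂law ν q := by
      refine lintegral_mono_ae ?_
      filter_upwards [ae_le_eLpNormEssSup (f := ratio p q) (μ := law ν q)] with x hx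
      rwa [← ofReal_norm, Real.norm_of_nonneg (ratio_nonneg hp hq x)] at hx
    _ = supRatio ν p q := by simp

theorem ae_smul_law_le_mhKernel (hp : IsProbDensity ν p) (hq : IsProbDensity ν q)
    (hac : law ν p ≪ law ν q) (hw : supRatio ν p q < ⊤) :
    ∀ᵐ x ∂law ν p, (supRatio ν p q).toNNReal⁻¹ • law ν p ≤ mhKernel ν hp hq x := by
  have hpos : 0 < (supRatio ν p q).toReal :=
    ENNReal.toReal_pos (one_pos.trans_le (one_le_supRatio hp hq hac)).ne' hw.ne
  refine hac.ae_le ?_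
  filter_upwards [ae_law_pos hq, ae_ratio_le hp hq hw] with x hx hxM
  rw [mhKernel_apply]
  -- The rejection atom at `x` is discarded.
  refine Measure.le_add_right ?_
  rw [law_eq_withDensity_ratio hp hq hac]
  rw [ENNReal.smul_def, ← withDensity_smul _ (measurable_ratio hp hq).ennreal_ofReal]
  refine withDensity_mono ?_
  filter_upwards [ae_law_pos hq, ae_ratio_le hp hq hw] with y hy hyM
  have := ratio_le_mul_accept hp hq hx hy hxM hyM
  rw [Pi.smul_apply, smul_eq_mul, ← ENNReal.ofReal_coe_nnreal, NNReal.coe_inv,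
    ENNReal.coe_toNNReal_eq_toReal, ← ENNReal.ofReal_mul (inv_nonneg.2 hpos.le)]
  exact ENNReal.ofReal_le_ofReal ((inv_mul_le_iff₀ hpos).2 this)

end MetropolisHastings

end IndepMH

theorem lemma2 {E : Type*} [MeasurableSpace E] (ν : Measure E) (p q : E → ℝ)
    (hp : IndepMH.IsProbDensity ν p) (hq : IndepMH.IsProbDensity ν q)
    (hac : IndepMH.law ν p ≪ IndepMH.law ν q)
    (hw : IndepMH.supRatio ν p q < ⊤)
    (wstar a : ℝ) (hwstar : wstar = (IndepMH.supRatio ν p q).toReal) (ha : a = 1 - 1 / wstar)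
    {Ω : Type*} [MeasurableSpace Ω] (μ : Measure Ω) [IsProbabilityMeasure μ] (X : ℕ → Ω → E)
    (hX : IndepMH.IsMarkovChain μ X (IndepMH.mhKernel ν hp hq) (IndepMH.law ν p))
    (g : E → ℝ) (hg : MemLp g 2 (IndepMH.law ν p)) :
    Summable (fun t : ℕ => IndepMH.autocorr μ X g (t + 1)) ∧
      IndepMH.iact μ X g ≤ (1 + a) / (1 - a) := by
  have := hp.isProbabilityMeasure_law
  have := IndepMH.isMarkovKernel_mhKernel hp hq
  have h1 : 1 ≤ (IndepMH.supRatio ν p q).toNNReal := by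
    have := ENNReal.toNNReal_mono hw.ne (IndepMH.one_le_supRatio hp hq hac)
    simpa using this
  have hac' : a = 1 - (((IndepMH.supRatio ν p q).toNNReal⁻¹ : NNReal) : ℝ) := by
    rw [ha, hwstar, one_div, NNReal.coe_inv, ENNReal.coe_toNNReal_eq_toReal]
  rw [hac']
  exact hX.summable_autocorr_and_iact_le (IndepMH.isReversible_mhKernel hp hq hac).invariant
    (inv_pos.2 (one_pos.trans_le h1)) (inv_le_one_of_one_le₀ h1)
    (IndepMH.ae_smul_law_le_mhKernel hp hq hac hw) hg
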